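/- Let $\mathbb D^2$ be the open bidisk, $\mathbb T^2$ the torus, and put $\|\lambda\|=\max(|\lambda^1|,|\lambda^2|)$ for $\lambda=(\lambda^1,\lambda^2)\in\mathbb C^2$. Let $\varphi$ be in the Schur class of the bidisk, that is, $\varphi$ is analytic on $\mathbb D^2$ with $|\varphi|\le 1$, and let $\tau\in\mathbb T^2$ be a $B$-point of $\varphi$, that is, $$\liminf_{\lambda\to\tau,\ \lambda\in\mathbb D^2}\frac{1-|\varphi(\lambda)|}{1-\|\lambda\|}<\infty .$$ Then $\varphi$ has a limit $\varphi(\tau)$ as $\lambda\to\tau$ nontangentially in $\mathbb D^2$ (that is, along every set $S\subset\mathbb D^2$ that has $\tau$ in its closure and on which $\|\tau-\lambda\|/(1-\|\lambda\|)$ is bounded), and there exists a function $h$ in the Pick class (analytic on the open upper half-plane with nonnegative imaginary part there) which extends analytically to $\mathbb C\setminus(-\infty,0]$ and is real-valued on $(0,\infty)$, such that $$h(1)=-\liminf_{\lambda\to\tau,\ \lambda\in\mathbb D^2}\frac{1-|\varphi(\lambda)|}{1-\|\lambda\|}$$ and such that, for every $\delta=(\delta^1,\delta^2)\in\mathbb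 C^2$ with $\operatorname{Re}(\overline{\tau^1}\delta^1)>0$ and $\operatorname{Re}(\overline{\tau^2}\delta^2)>0$, the directional derivative $D_{-\delta}\varphi(\tau)=\lim_{t\to0+}\bigl(\varphi(\tau-t\delta)-\varphi(\tau)\bigr)/t$ exists and $$D_{-\delta}\varphi(\tau)=\varphi(\tau)\,\overline{\tau^2}\delta^2\,h\!\left(\frac{\overline{\tau^2}\delta^2}{\overline{\tau^1}\delta^1}\right).$$ -/

import Mathlib

open Filter Topology

namespace BidiskPick

/-- The open bidisk `𝔻²`. -/
def bidisk : Set (ℂ × ℂ) := {z | ‖z.1‖ < 1 ∧ ‖z.2‖ < 1}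

/-- The torus `𝕋²`. -/
def torus : Set (ℂ × ℂ) := {z | ‖z.1‖ = 1 ∧ ‖z.2‖ = 1}

/-- The Schur class of the bidisk: analytic functions on `𝔻²` bounded by `1` in modulus.
Values of `φ` off the bidisk are irrelevant. -/
def IsSchur (φ : ℂ × ℂ → ℂ) : Prop :=
  AnalyticOnNhd ℂ φ bidisk ∧ ∀ z ∈ bidisk, ‖φ z‖ ≤ 1

/-- `liminf (1 - |φ(z)|) / (1 - ‖z‖)` as `z → τ` in `𝔻²`, an extended real number.
The norm of `ℂ × ℂ` is the maximum norm `‖z‖ = max |z¹| |z²|`. -/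
noncomputable def juliaLiminf (φ : ℂ × ℂ → ℂ) (τ : ℂ × ℂ) : EReal :=
  liminf (fun z : ℂ × ℂ => (((1 - ‖φ z‖) / (1 - ‖z‖) : ℝ) : EReal)) (𝓝[bidisk] τ)

/-- `τ ∈ ∂(𝔻²)` is a `B`-point of `φ` when the liminf above is finite; for a function of the
Schur class the quotient is nonnegative, so this says that the liminf is not `+∞`. -/
def IsBPoint (φ : ℂ × ℂ → ℂ) (τ : ℂ × ℂ) : Prop :=
  τ ∈ frontier bidisk ∧ juliaLiminf φ τ < ⊤

/-- A set `S ⊆ 𝔻²` approaches `τ` nontangentially when `τ` is in the closure of `S` and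
`‖τ - z‖ / (1 - ‖z‖)` is bounded on `S`. -/
def ApproachesNontangentially (S : Set (ℂ × ℂ)) (τ : ℂ × ℂ) : Prop :=
  S ⊆ bidisk ∧ τ ∈ closure S ∧ ∃ c : ℝ, ∀ z ∈ S, ‖τ - z‖ ≤ c * (1 - ‖z‖)

/-- `φ(z) → ω` as `z → τ` nontangentially in `𝔻²`; then `ω` is the boundary value `φ(τ)`. -/
def HasNontangentialLimit (φ : ℂ × ℂ → ℂ) (τ : ℂ × ℂ) (ω : ℂ) : Prop :=
  ∀ S : Set (ℂ × ℂ), ApproachesNontangentially S τ → Tendsto φ (𝓝[S] τ) (𝓝 ω)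

/-- The cone `H_τ = τ¹ℍ × τ²ℍ` for `τ ∈ 𝕋²`, where `ℍ` is the open right half-plane. -/
def coneAt (τ : ℂ × ℂ) : Set (ℂ × ℂ) :=
  {δ | 0 < (star τ.1 * δ.1).re ∧ 0 < (star τ.2 * δ.2).re}

/-- `D_v φ(τ) = d`, where `ω` is the value of `φ` at the boundary point `τ`:
the one-sided limit of `(φ(τ + t v) - ω) / t` as `t → 0+` exists and equals `d`. -/
def HasDirectionalDeriv (φ : ℂ × ℂ → ℂ) (τ : ℂ × ℂ) (ω : ℂ) (v : ℂ × ℂ) (d : ℂ) : Prop :=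
  Tendsto (fun t : ℝ => (φ (τ + t • v) - ω) / (t : ℂ)) (𝓝[>] (0 : ℝ)) (𝓝 d)

/-- The Pick class: analytic functions on the open upper half-plane with nonnegative
imaginary part. -/
def IsPick (h : ℂ → ℂ) : Prop :=
  AnalyticOnNhd ℂ h {z | 0 < z.im} ∧ ∀ z : ℂ, 0 < z.im → 0 ≤ (h z).im

end BidiskPick

/-! Everything rests on Julia's inequality. Schwarz–Pick on the bidisk says that `φ` does not
increase the larger of the two coordinatewise pseudohyperbolic distances, so in each instance one of
two one-variable inequalities holds. Letting one point tend to `τ` along an ultrafilter realising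
the liminf `α` gives a unimodular `ω` and `JuliaIneq`. This yields the nontangential limit `ω`, and
local bounds for the difference quotients `G t δ = (1 - star ω * φ (τ - tδτ)) / t` on the product of
two right half-planes.

In the normal direction `(1, 1)`, Julia bounds `|G t|` above and the liminf bounds its real part
below, so `G t → α`. A positive real direction becomes normal after composing `φ` with an affine
self-map of the bidisk, so there too `G t` has a real limit. Vitali's theorem spreads convergence
from real to complex directions: along the curve `z ↦ (z^(-1/2), z^(1/2))` over the slit plane, and
along complex multiples of a fixed direction, where the limit is homogeneous of degree one. Each `δ`
is a complex multiple of the curve's point at `z = δ.2 / δ.1`, so the limit is `-(δ.2 * h z)` for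
one function `h`. Since `0 ≤ re (G t δ)`, letting `δ` approach `(I / z, I)` gives `0 ≤ im (h z)`. -/

namespace BidiskPick

open Complex Metric Set

/-! ### Normal families and Vitali's theorem -/

/-- The pointwise limit along an ultrafilter of a locally bounded family of holomorphic functions
is holomorphic. -/
theorem exists_differentiableOn_ultrafilter_limit {ι : Type*} (𝒰 : Ultrafilter ι) {U : Set ℂ}
    (hU : IsOpen U) {f : ι → ℂ → ℂ}
    (hf : ∀ z ∈ U, ∃ r > 0, ∃ M : ℝ, ∀ᶠ i in (𝒰 : Filter ι),
      DifferentiableOn ℂ (f i) (ball z r) ∧ ∀ w ∈ ball z r, ‖f i w‖ ≤ M) :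
    ∃ g : ℂ → ℂ, DifferentiableOn ℂ g U ∧ ∀ z ∈ U, Tendsto (fun i => f i z) 𝒰 (𝓝 (g z)) := by
  have hlim : ∀ z, ∃ c, z ∈ U → Tendsto (fun i => f i z) 𝒰 (𝓝 c) := by
    intro z
    by_cases hz : z ∈ U
    · obtain ⟨r, hr, M, hM⟩ := hf z hz
      obtain ⟨c, -, hc⟩ := (isCompact_closedBall (0 : ℂ) M).ultrafilter_le_nhds
        (𝒰.map fun i => f i z) (by
          rw [le_principal_iff, Ultrafilter.mem_coe, Ultrafilter.mem_map]
          change ∀ᶠ i in (𝒰 : Filter ι), f i z ∈ closedBall 0 M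
          filter_upwards [hM] with i hi
          simpa using hi.2 z (mem_ball_self hr))
      exact ⟨c, fun _ => hc⟩
    · exact ⟨0, fun h => absurd h hz⟩
  choose g hg using hlim
  refine ⟨g, ?_, fun z hz => hg z hz⟩
  intro z₀ hz₀
  obtain ⟨r, hr, M, hM⟩ := hf z₀ hz₀
  obtain ⟨ρ, hρ, hρU⟩ := Metric.isOpen_iff.1 hU z₀ hz₀
  set s : ℝ := min r ρ / 2 with hs
  have hs0 : 0 < s := by positivity
  have hsr : 2 * s ≤ r := by rw [hs]; linarith [min_le_left r ρ]
  have hsρ : 2 * s ≤ ρ := by rw [hs]; linarith [min_le_right r ρ]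
  have hM0 : 0 ≤ M := by
    obtain ⟨i, hi⟩ := hM.exists
    exact (norm_nonneg _).trans (hi.2 z₀ (mem_ball_self hr))
  have hsub : ∀ w ∈ ball z₀ s, ball w s ⊆ ball z₀ r := fun w hw =>
    ball_subset_ball' (by rw [mem_ball] at hw; linarith)
  -- Equicontinuity from the Schwarz lemma: `f i` maps `ball w s` into the closed ball of radius `2
  -- * M` about `f i w`. This upgrades pointwise to locally uniform convergence.
  have hlip : ∀ w ∈ ball z₀ s, ∀ᶠ i in (𝒰 : Filter ι), ∀ v ∈ ball w s,
      dist (f i v) (f i w) ≤ (2 * M) / s * dist v w := by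
    intro w hw
    filter_upwards [hM] with i hi v hv
    refine dist_le_div_mul_dist_of_mapsTo_ball (hi.1.mono (hsub w hw)) ?_ hv
    intro x hx
    rw [mem_closedBall, dist_eq_norm]
    have h1 := hi.2 x (hsub w hw hx)
    have h2 := hi.2 w (hsub w hw (mem_ball_self hs0))
    linarith [norm_sub_le (f i x) (f i w)]
  have hmemU : ∀ w ∈ ball z₀ s, w ∈ U := fun w hw => hρU (ball_subset_ball (by linarith) hw)
  have hunif : TendstoLocallyUniformlyOn f g 𝒰 (ball z₀ s) := by
    rw [Metric.tendstoLocallyUniformlyOn_iff]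
    intro ε hε w hw
    set K : ℝ := (2 * M) / s with hK
    have hK0 : 0 ≤ K := by positivity
    set η : ℝ := min s (ε / (4 * (K + 1))) with hη
    have hη0 : 0 < η := by positivity
    have hKη : K * η ≤ ε / 4 := by
      have : η ≤ ε / (4 * (K + 1)) := min_le_right _ _
      calc K * η ≤ (K + 1) * (ε / (4 * (K + 1))) := by gcongr; linarith
        _ = ε / 4 := by field_simp
    refine ⟨ball w η ∩ ball z₀ s, inter_mem (mem_nhdsWithin_of_mem_nhds (ball_mem_nhds w hη0))
      self_mem_nhdsWithin, ?_⟩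
    have hclose : ∀ᶠ i in (𝒰 : Filter ι), dist (f i w) (g w) < ε / 4 :=
      (hg w (hmemU w hw)).eventually (ball_mem_nhds _ (by positivity))
    have hgl : ∀ v ∈ ball w s ∩ ball z₀ s, dist (g v) (g w) ≤ K * dist v w := by
      intro v hv
      refine le_of_tendsto ((hg v (hmemU v hv.2)).dist (hg w (hmemU w hw))) ?_
      filter_upwards [hlip w hw] with i hi using hi v hv.1
    filter_upwards [hlip w hw, hclose] with i hi hci v hv
    have hvs : v ∈ ball w s := ball_subset_ball (min_le_left _ _) hv.1
    have hd : K * dist v w ≤ ε / 4 := le_trans (by gcongr; exact (mem_ball.1 hv.1).le) hKη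
    have h1 := hi v hvs
    have h2 := hgl v ⟨hvs, hv.2⟩
    have h3 := dist_triangle4 (g v) (g w) (f i w) (f i v)
    rw [dist_comm (g w) (f i w), dist_comm (f i w) (f i v)] at h3
    linarith
  have hdiff : DifferentiableOn ℂ g (ball z₀ s) := by
    refine hunif.differentiableOn ?_ isOpen_ball
    filter_upwards [hM] with i hi
    exact hi.1.mono (ball_subset_ball (by linarith))
  exact (hdiff.differentiableAt (ball_mem_nhds _ hs0)).differentiableWithinAt

/-- Vitali's theorem: a locally bounded family of holomorphic functions on a connected open set
which converges on a set with an accumulation point converges to a holomorphic function. -/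
theorem exists_differentiableOn_limit {ι : Type*} {l : Filter ι} [l.NeBot] {U : Set ℂ}
    (hU : IsOpen U) (hUc : IsPreconnected U) {f : ι → ℂ → ℂ}
    (hf : ∀ z ∈ U, ∃ r > 0, ∃ M : ℝ, ∀ᶠ i in l,
      DifferentiableOn ℂ (f i) (ball z r) ∧ ∀ w ∈ ball z r, ‖f i w‖ ≤ M)
    {z₀ : ℂ} (hz₀ : z₀ ∈ U) (hc : ∃ᶠ z in 𝓝[≠] z₀, ∃ c, Tendsto (fun i => f i z) l (𝓝 c)) :
    ∃ g : ℂ → ℂ, DifferentiableOn ℂ g U ∧ ∀ z ∈ U, Tendsto (fun i => f i z) l (𝓝 (g z)) := by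
  have key : ∀ 𝒰 : Ultrafilter ι, ↑𝒰 ≤ l → ∃ g : ℂ → ℂ, DifferentiableOn ℂ g U ∧
      ∀ z ∈ U, Tendsto (fun i => f i z) 𝒰 (𝓝 (g z)) := by
    intro 𝒰 h𝒰
    refine exists_differentiableOn_ultrafilter_limit 𝒰 hU fun z hz => ?_
    obtain ⟨r, hr, M, hM⟩ := hf z hz
    exact ⟨r, hr, M, h𝒰 hM⟩
  obtain ⟨g, hgd, hg⟩ := key (Ultrafilter.of l) (Ultrafilter.of_le l)
  refine ⟨g, hgd, fun z hz => ?_⟩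
  rw [tendsto_iff_ultrafilter]
  intro 𝒰 h𝒰
  obtain ⟨g', hgd', hg'⟩ := key 𝒰 h𝒰
  -- Limits along different ultrafilters agree wherever the family converges along `l`, hence
  -- everywhere by the identity theorem.
  have heq : EqOn g' g U := by
    refine AnalyticOnNhd.eqOn_of_preconnected_of_frequently_eq (hgd'.analyticOnNhd hU)
      (hgd.analyticOnNhd hU) hUc hz₀ ?_
    have hev : ∀ᶠ z in 𝓝[≠] z₀, z ∈ U := mem_nhdsWithin_of_mem_nhds (hU.mem_nhds hz₀)
    refine (hc.and_eventually hev).mono ?_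
    rintro w ⟨⟨c, hc⟩, hw⟩
    rw [tendsto_nhds_unique (hg' w hw) (hc.mono_left h𝒰),
      tendsto_nhds_unique (hg w hw) (hc.mono_left (Ultrafilter.of_le l))]
  rw [← heq hz]
  exact hg' z hz

/-! ### Schwarz–Pick on the bidisk -/

/-- `(1 - |a|²)(1 - |b|²) = |1 - \bar a b|² - |a - b|²`. -/
theorem one_sub_normSq_mul (a b : ℂ) :
    (1 - ‖a‖ ^ 2) * (1 - ‖b‖ ^ 2) = ‖1 - star a * b‖ ^ 2 - ‖b - a‖ ^ 2 := by
  simp only [← Complex.normSq_eq_norm_sq, Complex.normSq_apply, Complex.star_def]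
  simp
  ring

theorem one_sub_star_mul_ne_zero {a b : ℂ} (ha : ‖a‖ < 1) (hb : ‖b‖ ≤ 1) :
    1 - star a * b ≠ 0 := by
  intro h
  have h1 : ‖star a * b‖ = 1 := by rw [← sub_eq_zero.1 h]; simp
  rw [norm_mul, norm_star] at h1
  nlinarith [norm_nonneg a, norm_nonneg b]

/-- The Möbius map `b ↦ (b - a) / (1 - \bar a b)` sends the closed disk into itself. -/
theorem norm_mobius_le_one {a b : ℂ} (ha : ‖a‖ < 1) (hb : ‖b‖ ≤ 1) :
    ‖(b - a) / (1 - star a * b)‖ ≤ 1 := by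
  have h := norm_pos_iff.2 (one_sub_star_mul_ne_zero ha hb)
  rw [norm_div, div_le_one h]
  have h1 := one_sub_normSq_mul a b
  have h2 : 0 ≤ (1 - ‖a‖ ^ 2) * (1 - ‖b‖ ^ 2) := by
    apply mul_nonneg <;> nlinarith [norm_nonneg a, norm_nonneg b]
  exact abs_le_of_sq_le_sq' (by linarith) h.le |>.2

theorem norm_mobius_lt_one {a b : ℂ} (ha : ‖a‖ < 1) (hb : ‖b‖ < 1) :
    ‖(b - a) / (1 - star a * b)‖ < 1 := by
  have h := norm_pos_iff.2 (one_sub_star_mul_ne_zero ha hb.le)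
  rw [norm_div, div_lt_one h]
  have h1 := one_sub_normSq_mul a b
  have h2 : 0 < (1 - ‖a‖ ^ 2) * (1 - ‖b‖ ^ 2) := by
    apply mul_pos <;> nlinarith [norm_nonneg a, norm_nonneg b]
  exact abs_lt_of_sq_lt_sq' (by linarith) h.le |>.2

/-- Two points of the disk at pseudohyperbolic distance at most `ρ` are values at `0` and `ρ` of a
holomorphic self-map of the disk. -/
theorem exists_disk_map {a b : ℂ} (ha : ‖a‖ < 1) (hb : ‖b‖ < 1) {ρ : ℝ} (hρ : 0 < ρ)
    (h : ‖b - a‖ ≤ ρ * ‖1 - star a * b‖) :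
    ∃ B : ℂ → ℂ, DifferentiableOn ℂ B (ball 0 1) ∧ (∀ ζ ∈ ball (0 : ℂ) 1, ‖B ζ‖ < 1) ∧
      B 0 = a ∧ B ρ = b := by
  set m := (b - a) / (1 - star a * b) with hm
  have hne := one_sub_star_mul_ne_zero ha hb.le
  -- Normalised so that `ζ ↦ c * ζ` sends `ρ` to the Möbius image `m` of `b`; undoing the Möbius map
  -- then sends `0` to `a` and `ρ` to `b`.
  set c := m / ρ with hc
  have hρ' : (ρ : ℂ) ≠ 0 := by exact_mod_cast hρ.ne'
  have hcρ : c * ρ = m := by rw [hc]; field_simp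
  have hc1 : ‖c‖ ≤ 1 := by
    rw [hc, hm, norm_div, norm_div, Complex.norm_real, Real.norm_of_nonneg hρ.le, div_div,
      div_le_one (mul_pos (norm_pos_iff.2 hne) hρ)]
    linarith
  have hna : ‖-a‖ < 1 := by rwa [norm_neg]
  have hcζ : ∀ ζ ∈ ball (0 : ℂ) 1, ‖c * ζ‖ < 1 := by
    intro ζ hζ
    rw [mem_ball_zero_iff] at hζ
    rw [norm_mul]
    nlinarith [norm_nonneg c, norm_nonneg ζ]
  refine ⟨fun ζ => (c * ζ - -a) / (1 - star (-a) * (c * ζ)), ?_, ?_, by simp, ?_⟩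
  · refine DifferentiableOn.div (by fun_prop) (by fun_prop) ?_
    intro ζ hζ
    exact one_sub_star_mul_ne_zero hna (hcζ ζ hζ).le
  · intro ζ hζ
    exact norm_mobius_lt_one hna (hcζ ζ hζ)
  · have hden : 1 + star a * m ≠ 0 := by
      have h1 : (1 + star a * m) * (1 - star a * b) = 1 - star a * a := by
        rw [hm]; field_simp; ring
      intro h0
      rw [h0, zero_mul] at h1
      exact one_sub_star_mul_ne_zero ha ha.le h1.symm
    simp only [hcρ, star_neg, neg_mul, sub_neg_eq_add]
    rw [div_eq_iff hden]
    have hm' : m * (1 - star a * b) = b - a := div_mul_cancel₀ _ hne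
    linear_combination hm'

/-- The Schwarz–Pick inequality on the bidisk for maps into the open disk. -/
theorem norm_sub_le_of_pseudohyperbolic_le {φ : ℂ × ℂ → ℂ} (hd : DifferentiableOn ℂ φ bidisk)
    (hφ : ∀ z ∈ bidisk, ‖φ z‖ < 1) {μ lam : ℂ × ℂ} (hμ : μ ∈ bidisk) (hl : lam ∈ bidisk)
    {ρ : ℝ} (hρ : 0 < ρ) (hρ1 : ρ < 1)
    (h₁ : ‖lam.1 - μ.1‖ ≤ ρ * ‖1 - star μ.1 * lam.1‖)
    (h₂ : ‖lam.2 - μ.2‖ ≤ ρ * ‖1 - star μ.2 * lam.2‖) :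
    ‖φ lam - φ μ‖ ≤ ρ * ‖1 - star (φ μ) * φ lam‖ := by
  obtain ⟨B, hBd, hB, hB0, hBρ⟩ := exists_disk_map hμ.1 hl.1 hρ h₁
  obtain ⟨C, hCd, hC, hC0, hCρ⟩ := exists_disk_map hμ.2 hl.2 hρ h₂
  have hmaps : MapsTo (fun ζ => (B ζ, C ζ)) (ball 0 1) bidisk := fun ζ hζ => ⟨hB ζ hζ, hC ζ hζ⟩
  have hfd : DifferentiableOn ℂ (fun ζ => φ (B ζ, C ζ)) (ball 0 1) :=
    hd.comp (hBd.prodMk hCd) hmaps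
  have hμ1 := hφ μ hμ
  have hρmem : (ρ : ℂ) ∈ ball (0 : ℂ) 1 := by
    rw [mem_ball_zero_iff, Complex.norm_real, Real.norm_of_nonneg hρ.le]; exact hρ1
  have hne : ∀ ζ ∈ ball (0 : ℂ) 1, 1 - star (φ μ) * φ (B ζ, C ζ) ≠ 0 := fun ζ hζ =>
    one_sub_star_mul_ne_zero hμ1 (hφ _ (hmaps hζ)).le
  have hgd : DifferentiableOn ℂ
      (fun ζ => (φ (B ζ, C ζ) - φ μ) / (1 - star (φ μ) * φ (B ζ, C ζ))) (ball 0 1) :=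
    (hfd.sub_const _).div ((hfd.const_mul _).const_sub _) hne
  have hS := Complex.norm_le_norm_of_mapsTo_ball hgd
    (fun ζ hζ => by
      rw [mem_closedBall_zero_iff]
      exact norm_mobius_le_one hμ1 (hφ _ (hmaps hζ)).le)
    (by simp [hB0, hC0]) (mem_ball_zero_iff.1 hρmem)
  simp only [hBρ, hCρ, norm_div, Complex.norm_real, Real.norm_of_nonneg hρ.le] at hS
  have hp := norm_pos_iff.2 (hne ρ hρmem)
  simp only [hBρ, hCρ] at hp
  exact (div_le_iff₀ hp).1 hS

/-- By `one_sub_normSq_mul`, failure of both alternatives means that both coordinate distances are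
strictly below the distance of the values. A `ρ` strictly in between contradicts the disk-map
estimate. -/
theorem schwarzPick_of_norm_lt {φ : ℂ × ℂ → ℂ} (hd : DifferentiableOn ℂ φ bidisk)
    (hφ : ∀ z ∈ bidisk, ‖φ z‖ < 1) {μ lam : ℂ × ℂ} (hμ : μ ∈ bidisk) (hl : lam ∈ bidisk) :
    (1 - ‖μ.1‖ ^ 2) * (1 - ‖lam.1‖ ^ 2) * ‖1 - star (φ μ) * φ lam‖ ^ 2 ≤
        (1 - ‖φ μ‖ ^ 2) * (1 - ‖φ lam‖ ^ 2) * ‖1 - star μ.1 * lam.1‖ ^ 2 ∨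
      (1 - ‖μ.2‖ ^ 2) * (1 - ‖lam.2‖ ^ 2) * ‖1 - star (φ μ) * φ lam‖ ^ 2 ≤
        (1 - ‖φ μ‖ ^ 2) * (1 - ‖φ lam‖ ^ 2) * ‖1 - star μ.2 * lam.2‖ ^ 2 := by
  by_contra! hcon
  obtain ⟨hc1, hc2⟩ := hcon
  have hn1 := norm_pos_iff.2 (one_sub_star_mul_ne_zero hμ.1 hl.1.le)
  have hn2 := norm_pos_iff.2 (one_sub_star_mul_ne_zero hμ.2 hl.2.le)
  have hn := norm_pos_iff.2 (one_sub_star_mul_ne_zero (hφ μ hμ) (hφ lam hl).le)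
  rw [one_sub_normSq_mul, one_sub_normSq_mul] at hc1 hc2
  set N1 := ‖1 - star μ.1 * lam.1‖
  set N2 := ‖1 - star μ.2 * lam.2‖
  set N := ‖1 - star (φ μ) * φ lam‖
  have hlt1 : ‖lam.1 - μ.1‖ / N1 < ‖φ lam - φ μ‖ / N := by
    rw [div_lt_div_iff₀ hn1 hn]
    exact abs_lt_of_sq_lt_sq' (by nlinarith) (by positivity) |>.2
  have hlt2 : ‖lam.2 - μ.2‖ / N2 < ‖φ lam - φ μ‖ / N := by
    rw [div_lt_div_iff₀ hn2 hn]
    exact abs_lt_of_sq_lt_sq' (by nlinarith) (by positivity) |>.2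
  obtain ⟨ρ, hρ1, hρ2⟩ := exists_between (max_lt hlt1 hlt2)
  have hρ0 : 0 < ρ := lt_of_le_of_lt (le_max_of_le_left (by positivity)) hρ1
  have hlast : ‖φ lam - φ μ‖ / N < 1 := by
    have := norm_mobius_lt_one (hφ μ hμ) (hφ lam hl)
    rwa [norm_div] at this
  have := norm_sub_le_of_pseudohyperbolic_le hd hφ hμ hl hρ0 (hρ2.trans hlast)
    ((div_le_iff₀ hn1).1 ((le_max_left _ _).trans hρ1.le))
    ((div_le_iff₀ hn2).1 ((le_max_right _ _).trans hρ1.le))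
  rw [lt_div_iff₀ hn] at hρ2
  exact absurd this (not_le.2 hρ2)

theorem IsSchur.differentiableOn {φ : ℂ × ℂ → ℂ} (hφ : IsSchur φ) : DifferentiableOn ℂ φ bidisk :=
  hφ.1.differentiableOn

/-- The Schwarz–Pick inequality on the bidisk. -/
theorem IsSchur.schwarzPick {φ : ℂ × ℂ → ℂ} (hφ : IsSchur φ) {μ lam : ℂ × ℂ}
    (hμ : μ ∈ bidisk) (hl : lam ∈ bidisk) :
    (1 - ‖μ.1‖ ^ 2) * (1 - ‖lam.1‖ ^ 2) * ‖1 - star (φ μ) * φ lam‖ ^ 2 ≤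
        (1 - ‖φ μ‖ ^ 2) * (1 - ‖φ lam‖ ^ 2) * ‖1 - star μ.1 * lam.1‖ ^ 2 ∨
      (1 - ‖μ.2‖ ^ 2) * (1 - ‖lam.2‖ ^ 2) * ‖1 - star (φ μ) * φ lam‖ ^ 2 ≤
        (1 - ‖φ μ‖ ^ 2) * (1 - ‖φ lam‖ ^ 2) * ‖1 - star μ.2 * lam.2‖ ^ 2 := by
  -- The scaled function `r * φ` maps into the open disk. As `r → 1`, one of the two alternatives
  -- holds frequently and so survives the limit.
  have hr : ∀ r ∈ Ioo (0 : ℝ) 1, _ := fun r hr =>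
    schwarzPick_of_norm_lt (φ := fun z => (r : ℂ) * φ z) (hφ.differentiableOn.const_mul _)
      (fun z hz => by
        rw [norm_mul, Complex.norm_real, Real.norm_of_nonneg hr.1.le]
        nlinarith [hφ.2 z hz, hr.1, hr.2, norm_nonneg (φ z)]) hμ hl
  have hmem : Ioo (0 : ℝ) 1 ∈ 𝓝[<] (1 : ℝ) := Ioo_mem_nhdsLT one_pos
  have hcoe : Tendsto (fun r : ℝ => (r : ℂ)) (𝓝[<] 1) (𝓝 1) := by
    simpa using (Complex.continuous_ofReal.tendsto (1 : ℝ)).mono_left nhdsWithin_le_nhds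
  have ha : Tendsto (fun r : ℝ => (r : ℂ) * φ μ) (𝓝[<] 1) (𝓝 (φ μ)) := by
    simpa using hcoe.mul_const (φ μ)
  have hb : Tendsto (fun r : ℝ => (r : ℂ) * φ lam) (𝓝[<] 1) (𝓝 (φ lam)) := by
    simpa using hcoe.mul_const (φ lam)
  have hA := (((ha.star.mul hb).const_sub 1).norm.pow 2)
  have hB := (((ha.norm.pow 2).const_sub 1).mul ((hb.norm.pow 2).const_sub 1))
  have hfreq := (eventually_of_mem hmem hr).frequently
  rw [frequently_or_distrib] at hfreq
  refine hfreq.imp (fun h => ?_) (fun h => ?_)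
  · exact le_of_tendsto_of_tendsto_of_frequently (hA.const_mul _) (hB.mul_const _) h
  · exact le_of_tendsto_of_tendsto_of_frequently (hA.const_mul _) (hB.mul_const _) h

/-! ### Approach points in the cone and the liminf -/

/-- The point `τ - tδτ` of the bidisk, in coordinates `δ` for which the cone at `τ` is the product
of two right half-planes. -/
def conePoint (τ δ : ℂ × ℂ) (t : ℝ) : ℂ × ℂ := (τ.1 * (1 - t * δ.1), τ.2 * (1 - t * δ.2))

/-- The product of two right half-planes. -/
def rightHalfPlanes : Set (ℂ × ℂ) := {δ | 0 < δ.1.re ∧ 0 < δ.2.re}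

/-- The difference quotient `(1 - \bar ω φ(τ - tδτ)) / t`. -/
noncomputable def coneQuotient (φ : ℂ × ℂ → ℂ) (τ : ℂ × ℂ) (ω : ℂ) (t : ℝ) (δ : ℂ × ℂ) : ℂ :=
  (1 - star ω * φ (conePoint τ δ t)) / t

theorem norm_eq_one_of_mem_torus {τ : ℂ × ℂ} (hτ : τ ∈ torus) : ‖τ‖ = 1 := by
  rw [Prod.norm_def, hτ.1, hτ.2, max_self]

theorem norm_lt_one_of_mem_bidisk {z : ℂ × ℂ} (hz : z ∈ bidisk) : ‖z‖ < 1 := by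
  rw [Prod.norm_def]; exact max_lt hz.1 hz.2

theorem normSq_one_sub_mul_le {t : ℝ} (ht : 0 < t) {d : ℂ} (h : t * ‖d‖ ^ 2 ≤ d.re) :
    ‖1 - t * d‖ ^ 2 ≤ 1 - t * d.re := by
  rw [← Complex.normSq_eq_norm_sq, Complex.normSq_apply] at *
  simp
  nlinarith [mul_le_mul_of_nonneg_left h ht.le]

theorem norm_one_sub_mul_lt {t : ℝ} (ht : 0 < t) {d : ℂ} (hd : 0 < d.re)
    (h : t * ‖d‖ ^ 2 ≤ d.re) : ‖1 - t * d‖ < 1 := by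
  have := normSq_one_sub_mul_le ht h
  have h2 := mul_pos ht hd
  exact abs_lt_of_sq_lt_sq' (by linarith) zero_le_one |>.2

theorem conePoint_mem_bidisk {τ δ : ℂ × ℂ} (hτ : τ ∈ torus) (hδ : δ ∈ rightHalfPlanes) {t : ℝ}
    (ht : 0 < t) (h1 : t * ‖δ.1‖ ^ 2 ≤ δ.1.re) (h2 : t * ‖δ.2‖ ^ 2 ≤ δ.2.re) :
    conePoint τ δ t ∈ bidisk := by
  constructor
  · simpa [conePoint, hτ.1] using norm_one_sub_mul_lt ht hδ.1 h1
  · simpa [conePoint, hτ.2] using norm_one_sub_mul_lt ht hδ.2 h2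

theorem one_one_mem_rightHalfPlanes : ((1, 1) : ℂ × ℂ) ∈ rightHalfPlanes := by
  simp [rightHalfPlanes]

theorem conePoint_one_mem_bidisk {τ : ℂ × ℂ} (hτ : τ ∈ torus) {t : ℝ} (ht : t ∈ Ioo (0 : ℝ) 1) :
    conePoint τ (1, 1) t ∈ bidisk :=
  conePoint_mem_bidisk hτ one_one_mem_rightHalfPlanes ht.1 (by simpa using ht.2.le)
    (by simpa using ht.2.le)

theorem norm_one_sub_ofReal {t : ℝ} (ht : t ∈ Ioo (0 : ℝ) 1) : ‖(1 : ℂ) - t‖ = 1 - t := by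
  have : (1 : ℂ) - t = ((1 - t : ℝ) : ℂ) := by push_cast; rfl
  rw [this, Complex.norm_real, Real.norm_of_nonneg (by linarith [ht.2])]

theorem norm_conePoint_one {τ : ℂ × ℂ} (hτ : τ ∈ torus) {t : ℝ} (ht : t ∈ Ioo (0 : ℝ) 1) :
    ‖conePoint τ (1, 1) t‖ = 1 - t := by
  simp [conePoint, Prod.norm_def, hτ.1, hτ.2, norm_one_sub_ofReal ht]

theorem tendsto_conePoint_one {τ : ℂ × ℂ} (hτ : τ ∈ torus) :
    Tendsto (fun t : ℝ => conePoint τ (1, 1) t) (𝓝[>] 0) (𝓝[bidisk] τ) := by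
  refine tendsto_nhdsWithin_iff.2 ⟨?_, ?_⟩
  · have hc : Continuous fun t : ℝ => conePoint τ (1, 1) t := by unfold conePoint; fun_prop
    have := (hc.tendsto 0).mono_left (nhdsWithin_le_nhds (s := Ioi 0))
    simpa [conePoint] using this
  · filter_upwards [Ioo_mem_nhdsGT one_pos] with t ht using conePoint_one_mem_bidisk hτ ht

theorem IsSchur.quotient_nonneg {φ : ℂ × ℂ → ℂ} (hφ : IsSchur φ) {z : ℂ × ℂ} (hz : z ∈ bidisk) :
    0 ≤ (1 - ‖φ z‖) / (1 - ‖z‖) :=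
  div_nonneg (by linarith [hφ.2 z hz]) (by linarith [norm_lt_one_of_mem_bidisk hz])

theorem IsSchur.exists_juliaLiminf_eq {φ : ℂ × ℂ → ℂ} (hφ : IsSchur φ) {τ : ℂ × ℂ}
    (h : juliaLiminf φ τ < ⊤) : ∃ α : ℝ, 0 ≤ α ∧ juliaLiminf φ τ = α := by
  have h0 : 0 ≤ juliaLiminf φ τ := by
    refine le_liminf_of_le (by isBoundedDefault) ?_
    filter_upwards [self_mem_nhdsWithin] with z hz
    exact_mod_cast hφ.quotient_nonneg hz
  have hbot : juliaLiminf φ τ ≠ ⊥ := fun hb => by simp [hb] at h0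
  refine ⟨(juliaLiminf φ τ).toReal, EReal.toReal_nonneg h0, ?_⟩
  rw [EReal.coe_toReal h.ne hbot]

/-- A finite liminf is a cluster value, so some ultrafilter tending to `τ` in the bidisk attains it
as a limit. -/
theorem mapClusterPt_quotient {φ : ℂ × ℂ → ℂ} {τ : ℂ × ℂ} {α : ℝ} (hα : juliaLiminf φ τ = α) :
    MapClusterPt α (𝓝[bidisk] τ) (fun z => (1 - ‖φ z‖) / (1 - ‖z‖)) := by
  rw [mapClusterPt_iff_frequently]
  intro s hs
  obtain ⟨ε, hε, hεs⟩ := Metric.mem_nhds_iff.1 hs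
  have h1 : ∃ᶠ z in 𝓝[bidisk] τ,
      (((1 - ‖φ z‖) / (1 - ‖z‖) : ℝ) : EReal) < ((α + ε : ℝ) : EReal) := by
    refine frequently_lt_of_liminf_lt (by isBoundedDefault) ?_
    change juliaLiminf φ τ < _
    rw [hα]; exact_mod_cast (by linarith)
  have h2 : ∀ᶠ z in 𝓝[bidisk] τ,
      ((α - ε : ℝ) : EReal) < (((1 - ‖φ z‖) / (1 - ‖z‖) : ℝ) : EReal) := by
    refine eventually_lt_of_lt_liminf ?_ (by isBoundedDefault)
    change _ < juliaLiminf φ τ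
    rw [hα]; exact_mod_cast (by linarith)
  refine (h1.and_eventually h2).mono fun z hz => hεs ?_
  have h3 := EReal.coe_lt_coe_iff.1 hz.1
  have h4 := EReal.coe_lt_coe_iff.1 hz.2
  rw [mem_ball, Real.dist_eq, abs_lt]
  constructor <;> linarith

/-! ### Julia's inequality and the nontangential limit -/

/-- Julia's inequality for the bidisk at a boundary point `τ`, with boundary value `ω`. -/
def JuliaIneq (φ : ℂ × ℂ → ℂ) (τ : ℂ × ℂ) (ω : ℂ) (α : ℝ) : Prop :=
  ∀ z ∈ bidisk,
    (1 - ‖z.1‖ ^ 2) * ‖1 - star ω * φ z‖ ^ 2 ≤ α * (1 - ‖φ z‖ ^ 2) * ‖1 - star τ.1 * z.1‖ ^ 2 ∨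
    (1 - ‖z.2‖ ^ 2) * ‖1 - star ω * φ z‖ ^ 2 ≤ α * (1 - ‖φ z‖ ^ 2) * ‖1 - star τ.2 * z.2‖ ^ 2

/-- Replaces a squared coordinate norm `a` by the squared maximum norm `n`, so that both
alternatives involve the same quotient. -/
theorem le_of_schwarzPick {a b m n N K : ℝ} (ha : 0 < 1 - n) (han : 1 - n ≤ 1 - a) (hb : 0 ≤ b)
    (h : (1 - a) * b * N ≤ m * K) (hN : 0 ≤ N) : b * N ≤ m / (1 - n) * K := by
  rw [div_mul_eq_mul_div, le_div_iff₀ ha]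
  nlinarith [mul_nonneg hb hN]

theorem IsSchur.exists_juliaIneq {φ : ℂ × ℂ → ℂ} (hφ : IsSchur φ) {τ : ℂ × ℂ} (hτ : τ ∈ torus)
    {α : ℝ} (hα : juliaLiminf φ τ = α) : ∃ ω : ℂ, ‖ω‖ = 1 ∧ JuliaIneq φ τ ω α := by
  obtain ⟨𝒰, h𝒰, hq⟩ := mapClusterPt_iff_ultrafilter.1 (mapClusterPt_quotient hα)
  have hmem : ∀ᶠ z in (𝒰 : Filter (ℂ × ℂ)), z ∈ bidisk := h𝒰 self_mem_nhdsWithin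
  have hid : Tendsto (fun z : ℂ × ℂ => z) 𝒰 (𝓝 τ) := h𝒰.trans nhdsWithin_le_nhds
  obtain ⟨ω, -, hω⟩ := (isCompact_closedBall (0 : ℂ) 1).ultrafilter_le_nhds (𝒰.map φ) (by
    rw [le_principal_iff, Ultrafilter.mem_coe, Ultrafilter.mem_map]
    change ∀ᶠ z in (𝒰 : Filter (ℂ × ℂ)), φ z ∈ closedBall 0 1
    filter_upwards [hmem] with z hz
    simpa using hφ.2 z hz)
  replace hω : Tendsto φ 𝒰 (𝓝 ω) := hω
  have hnorm : Tendsto (fun z : ℂ × ℂ => ‖z‖) 𝒰 (𝓝 1) := by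
    simpa [norm_eq_one_of_mem_torus hτ] using hid.norm
  have hω1 : ‖ω‖ = 1 := by
    have h1 : Tendsto (fun z => (1 - ‖φ z‖) / (1 - ‖z‖) * (1 - ‖z‖)) 𝒰 (𝓝 (α * (1 - 1))) :=
      hq.mul (hnorm.const_sub 1)
    have h2 : Tendsto (fun z => (1 - ‖φ z‖) / (1 - ‖z‖) * (1 - ‖z‖)) 𝒰 (𝓝 (1 - ‖ω‖)) := by
      refine (hω.norm.const_sub 1).congr' ?_
      filter_upwards [hmem] with z hz
      have := norm_lt_one_of_mem_bidisk hz
      rw [div_mul_cancel₀ _ (by linarith)]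
    have := tendsto_nhds_unique h1 h2
    linarith
  refine ⟨ω, hω1, fun z hz => ?_⟩
  -- Squaring the norms multiplies the quotient by `(1 + ‖φ μ‖) / (1 + ‖μ‖)`, which tends to `1`.
  have hratio : Tendsto (fun μ => (1 - ‖φ μ‖ ^ 2) / (1 - ‖μ‖ ^ 2)) 𝒰 (𝓝 α) := by
    have h1 : Tendsto (fun μ => (1 - ‖φ μ‖) / (1 - ‖μ‖) * ((1 + ‖φ μ‖) / (1 + ‖μ‖))) 𝒰
        (𝓝 (α * ((1 + ‖ω‖) / (1 + 1)))) :=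
      hq.mul ((hω.norm.const_add 1).div (hnorm.const_add 1) (by norm_num))
    rw [hω1, div_self (by norm_num), mul_one] at h1
    refine h1.congr' ?_
    filter_upwards [hmem] with μ hμ
    rw [div_mul_div_comm]
    congr 1 <;> ring
  have hA : Tendsto (fun μ => ‖1 - star (φ μ) * φ z‖ ^ 2) 𝒰 (𝓝 (‖1 - star ω * φ z‖ ^ 2)) :=
    ((hω.star.mul_const _).const_sub 1).norm.pow 2
  have hB1 : Tendsto (fun μ : ℂ × ℂ => ‖1 - star μ.1 * z.1‖ ^ 2) 𝒰
      (𝓝 (‖1 - star τ.1 * z.1‖ ^ 2)) :=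
    ((((continuous_fst.tendsto τ).comp hid).star.mul_const _).const_sub 1).norm.pow 2
  have hB2 : Tendsto (fun μ : ℂ × ℂ => ‖1 - star μ.2 * z.2‖ ^ 2) 𝒰
      (𝓝 (‖1 - star τ.2 * z.2‖ ^ 2)) :=
    ((((continuous_snd.tendsto τ).comp hid).star.mul_const _).const_sub 1).norm.pow 2
  have hev : ∀ᶠ μ in (𝒰 : Filter (ℂ × ℂ)),
      (1 - ‖z.1‖ ^ 2) * ‖1 - star (φ μ) * φ z‖ ^ 2 ≤
        (1 - ‖φ μ‖ ^ 2) / (1 - ‖μ‖ ^ 2) * (1 - ‖φ z‖ ^ 2) * ‖1 - star μ.1 * z.1‖ ^ 2 ∨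
      (1 - ‖z.2‖ ^ 2) * ‖1 - star (φ μ) * φ z‖ ^ 2 ≤
        (1 - ‖φ μ‖ ^ 2) / (1 - ‖μ‖ ^ 2) * (1 - ‖φ z‖ ^ 2) * ‖1 - star μ.2 * z.2‖ ^ 2 := by
    filter_upwards [hmem] with μ hμ
    have hn : 0 < 1 - ‖μ‖ ^ 2 := by
      nlinarith [norm_lt_one_of_mem_bidisk hμ, norm_nonneg μ]
    refine (hφ.schwarzPick hμ hz).imp (fun h => ?_) (fun h => ?_)
    · rw [mul_assoc]
      refine le_of_schwarzPick hn ?_ ?_ (by rwa [mul_assoc (1 - ‖φ μ‖ ^ 2)] at h) (by positivity)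
      · have := norm_fst_le μ; gcongr
      · nlinarith [hz.1, norm_nonneg z.1]
    · rw [mul_assoc]
      refine le_of_schwarzPick hn ?_ ?_ (by rwa [mul_assoc (1 - ‖φ μ‖ ^ 2)] at h) (by positivity)
      · have := norm_snd_le μ; gcongr
      · nlinarith [hz.2, norm_nonneg z.2]
  have hfreq := hev.frequently
  rw [frequently_or_distrib] at hfreq
  refine hfreq.imp (fun h => ?_) (fun h => ?_)
  · exact le_of_tendsto_of_tendsto_of_frequently (hA.const_mul _)
      ((hratio.mul_const _).mul hB1) h
  · exact le_of_tendsto_of_tendsto_of_frequently (hA.const_mul _)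
      ((hratio.mul_const _).mul hB2) h

theorem one_sub_norm_le {ω w : ℂ} (hω : ‖ω‖ = 1) : 1 - ‖w‖ ≤ (1 - star ω * w).re := by
  have := Complex.re_le_norm (star ω * w)
  rw [norm_mul, norm_star, hω, one_mul] at this
  rw [Complex.sub_re, Complex.one_re]
  linarith

theorem one_sub_norm_le_norm {ω w : ℂ} (hω : ‖ω‖ = 1) : 1 - ‖w‖ ≤ ‖1 - star ω * w‖ :=
  (one_sub_norm_le hω).trans (Complex.re_le_norm _)

theorem star_mul_self_of_norm_eq_one {ω : ℂ} (hω : ‖ω‖ = 1) : star ω * ω = 1 := by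
  rw [Complex.star_def, Complex.conj_mul', hω]; simp

theorem one_sub_star_mul_eq {ω w : ℂ} (hω : ‖ω‖ = 1) : 1 - star ω * w = star ω * (ω - w) := by
  rw [mul_sub, star_mul_self_of_norm_eq_one hω]

theorem norm_one_sub_star_mul {ω w : ℂ} (hω : ‖ω‖ = 1) : ‖1 - star ω * w‖ = ‖ω - w‖ := by
  rw [one_sub_star_mul_eq hω, norm_mul, norm_star, hω, one_mul]

/-- Here `N = ‖ω - φ z‖ ^ 2`, `s = ‖z‖`, and `d` is the distance to `τ` in one coordinate. The
nontangential bound on one factor `d` cancels `1 - s`, leaving a bound linear in `d`. -/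
theorem sq_le_of_julia_coord {c s d x N α b : ℝ} (hα : 0 ≤ α) (hx0 : 0 ≤ x)
    (hxs : x ≤ s) (hs : s < 1) (hd0 : 0 ≤ d)
    (hd : d ≤ c * (1 - s))
    (h : (1 - x ^ 2) * N ≤ α * (1 - b ^ 2) * d ^ 2) (hN : 0 ≤ N) : N ≤ α * c * d := by
  have h1 : 1 - s ≤ 1 - x ^ 2 := by nlinarith
  have h2 : α * (1 - b ^ 2) * d ^ 2 ≤ α * d ^ 2 := by
    have : α * (1 - b ^ 2) ≤ α := by nlinarith
    gcongr
  have h3 : α * d ^ 2 ≤ α * (c * (1 - s) * d) := by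
    gcongr; nlinarith
  have h4 : (1 - s) * N ≤ (1 - s) * (α * c * d) := by nlinarith
  exact le_of_mul_le_mul_left h4 (by linarith)

theorem JuliaIneq.hasNontangentialLimit {φ : ℂ × ℂ → ℂ} {τ : ℂ × ℂ}
    (hτ : τ ∈ torus) {ω : ℂ} (hω : ‖ω‖ = 1) {α : ℝ} (hα : 0 ≤ α) (hJ : JuliaIneq φ τ ω α) :
    HasNontangentialLimit φ τ ω := by
  rintro S ⟨hS, -, c, hc⟩
  have hbound : ∀ z ∈ S, ‖φ z - ω‖ ^ 2 ≤ α * max c 0 * ‖τ - z‖ := by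
    intro z hz
    have hzb := hS hz
    have hz1 := norm_lt_one_of_mem_bidisk hzb
    have hc' : ‖τ - z‖ ≤ max c 0 * (1 - ‖z‖) :=
      (hc z hz).trans (by gcongr; exact le_max_left _ _)
    have hJz := hJ z hzb
    rw [norm_one_sub_star_mul hω, norm_one_sub_star_mul hτ.1, norm_one_sub_star_mul hτ.2] at hJz
    rw [norm_sub_rev]
    have hm : 0 ≤ max c 0 := le_max_right _ _
    rcases hJz with h | h
    · have hle : ‖τ.1 - z.1‖ ≤ ‖τ - z‖ := norm_fst_le (τ - z)
      exact (sq_le_of_julia_coord hα (norm_nonneg _) (norm_fst_le z) hz1 (norm_nonneg _)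
        (hle.trans hc') h (by positivity)).trans (by gcongr)
    · have hle : ‖τ.2 - z.2‖ ≤ ‖τ - z‖ := norm_snd_le (τ - z)
      exact (sq_le_of_julia_coord hα (norm_nonneg _) (norm_snd_le z) hz1 (norm_nonneg _)
        (hle.trans hc') h (by positivity)).trans (by gcongr)
  have hlim : Tendsto (fun z : ℂ × ℂ => α * max c 0 * ‖τ - z‖) (𝓝[S] τ) (𝓝 0) := by
    have hcont : Continuous fun z : ℂ × ℂ => α * max c 0 * ‖τ - z‖ := by fun_prop
    simpa using (hcont.tendsto τ).mono_left nhdsWithin_le_nhds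
  have hsq : Tendsto (fun z => ‖φ z - ω‖ ^ 2) (𝓝[S] τ) (𝓝 0) :=
    squeeze_zero' (Eventually.of_forall fun _ => by positivity)
      (eventually_of_mem self_mem_nhdsWithin hbound) hlim
  rw [tendsto_iff_norm_sub_tendsto_zero]
  simpa [Real.sqrt_sq] using hsq.sqrt

/-! ### Normal derivative and bounds on difference quotients -/

theorem norm_coneQuotient {φ : ℂ × ℂ → ℂ} {τ δ : ℂ × ℂ} {ω : ℂ} {t : ℝ} (ht : 0 < t) :
    ‖coneQuotient φ τ ω t δ‖ = ‖1 - star ω * φ (conePoint τ δ t)‖ / t := by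
  rw [coneQuotient, norm_div, Complex.norm_real, Real.norm_of_nonneg ht.le]

theorem coneQuotient_re_nonneg {φ : ℂ × ℂ → ℂ} (hφ : IsSchur φ) {τ δ : ℂ × ℂ} {ω : ℂ}
    (hω : ‖ω‖ = 1) {t : ℝ} (ht : 0 < t) (hmem : conePoint τ δ t ∈ bidisk) :
    0 ≤ (coneQuotient φ τ ω t δ).re := by
  rw [coneQuotient, Complex.div_ofReal_re]
  exact div_nonneg (by linarith [one_sub_norm_le hω (w := φ (conePoint τ δ t)), hφ.2 _ hmem]) ht.le

theorem norm_one_sub_star_mul_mul {τ : ℂ} (hτ : ‖τ‖ = 1) {t : ℝ} (ht : 0 < t) (d : ℂ) :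
    ‖1 - star τ * (τ * (1 - t * d))‖ = t * ‖d‖ := by
  rw [← mul_assoc, star_mul_self_of_norm_eq_one hτ, one_mul, sub_sub_cancel, norm_mul,
    Complex.norm_real, Real.norm_of_nonneg ht.le]

/-- The derivative along the normal direction at a `B`-point. -/
theorem tendsto_coneQuotient_one {φ : ℂ × ℂ → ℂ} (hφ : IsSchur φ) {τ : ℂ × ℂ}
    (hτ : τ ∈ torus) {ω : ℂ} (hω : ‖ω‖ = 1) {α : ℝ} (hα0 : 0 ≤ α) (hα : juliaLiminf φ τ = α)
    (hJ : JuliaIneq φ τ ω α) :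
    Tendsto (fun t => coneQuotient φ τ ω t (1, 1)) (𝓝[>] 0) (𝓝 (α : ℂ)) := by
  have hIoo : Ioo (0 : ℝ) 1 ∈ 𝓝[>] (0 : ℝ) := Ioo_mem_nhdsGT one_pos
  set q : ℝ → ℝ := fun t => (1 - ‖φ (conePoint τ (1, 1) t)‖) / t with hq
  -- The factor `2 - t` comes from `1 - (1 - t) ^ 2 = t * (2 - t)`, and the `2` from `1 - b ^ 2 ≤ 2
  -- * (1 - b) ≤ 2 * N`, after which one factor `N` cancels.
  have hnle : ∀ t ∈ Ioo (0 : ℝ) 1, ‖coneQuotient φ τ ω t (1, 1)‖ ≤ 2 * α / (2 - t) := by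
    intro t ht
    have hmem := conePoint_one_mem_bidisk hτ ht
    have hb := hφ.2 _ hmem
    have h1 := hJ _ hmem
    have e1 : ‖(conePoint τ (1, 1) t).1‖ = 1 - t := by
      simp [conePoint, hτ.1, norm_one_sub_ofReal ht]
    have e2 : ‖(conePoint τ (1, 1) t).2‖ = 1 - t := by
      simp [conePoint, hτ.2, norm_one_sub_ofReal ht]
    have e3 : ‖1 - star τ.1 * (conePoint τ (1, 1) t).1‖ = t := by
      simpa [conePoint] using norm_one_sub_star_mul_mul hτ.1 ht.1 1
    have e4 : ‖1 - star τ.2 * (conePoint τ (1, 1) t).2‖ = t := by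
      simpa [conePoint] using norm_one_sub_star_mul_mul hτ.2 ht.1 1
    rw [e1, e2, e3, e4, or_self] at h1
    have hN := one_sub_norm_le_norm hω (w := φ (conePoint τ (1, 1) t))
    rw [norm_coneQuotient ht.1]
    set N := ‖1 - star ω * φ (conePoint τ (1, 1) t)‖
    set b := ‖φ (conePoint τ (1, 1) t)‖
    have hb0 : 0 ≤ b := norm_nonneg _
    have hN0 : 0 ≤ N := norm_nonneg _
    have ht2 : 0 < 2 - t := by linarith [ht.2]
    rw [div_le_div_iff₀ ht.1 ht2]
    rcases hN0.eq_or_lt with h0 | h0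
    · rw [← h0]; nlinarith [mul_nonneg hα0 ht.1.le, ht.1]
    · have h2 : α * (1 - b ^ 2) ≤ α * (2 * N) := by
        gcongr; nlinarith
      have h3 : t * N * ((2 - t) * N) ≤ t * N * (2 * α * t) := by nlinarith [sq_nonneg t]
      have := le_of_mul_le_mul_left h3 (mul_pos ht.1 h0)
      linarith
  have hqle : ∀ t ∈ Ioo (0 : ℝ) 1, q t ≤ (coneQuotient φ τ ω t (1, 1)).re := by
    intro t ht
    rw [coneQuotient, Complex.div_ofReal_re]
    have := one_sub_norm_le hω (w := φ (conePoint τ (1, 1) t))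
    exact div_le_div_of_nonneg_right this ht.1.le
  have hup : Tendsto (fun t : ℝ => 2 * α / (2 - t)) (𝓝[>] 0) (𝓝 α) := by
    have : ContinuousAt (fun t : ℝ => 2 * α / (2 - t)) 0 :=
      continuousAt_const.div (by fun_prop) (by norm_num)
    have h := this.tendsto.mono_left (nhdsWithin_le_nhds (s := Ioi 0))
    simpa using h
  have hqlim : Tendsto q (𝓝[>] 0) (𝓝 α) := by
    refine tendsto_order.2 ⟨fun a ha => ?_, fun a ha => ?_⟩
    · have h2 : ∀ᶠ z in 𝓝[bidisk] τ,
          (a : EReal) < (((1 - ‖φ z‖) / (1 - ‖z‖) : ℝ) : EReal) := by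
        refine eventually_lt_of_lt_liminf ?_ (by isBoundedDefault)
        change _ < juliaLiminf φ τ
        rw [hα]; exact_mod_cast ha
      filter_upwards [(tendsto_conePoint_one hτ).eventually h2, hIoo] with t h ht
      have h3 := EReal.coe_lt_coe_iff.1 h
      rwa [norm_conePoint_one hτ ht, sub_sub_cancel] at h3
    · filter_upwards [hup.eventually (gt_mem_nhds ha), hIoo] with t h ht
      exact ((hqle t ht).trans ((Complex.re_le_norm _).trans (hnle t ht))).trans_lt h
  -- Modulus asymptotically at most `α` and real part at least `q → α` force convergence to `α`:
  -- expand the square.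
  have hsq : Tendsto (fun t => ‖coneQuotient φ τ ω t (1, 1) - α‖ ^ 2) (𝓝[>] 0) (𝓝 0) := by
    have hlim : Tendsto (fun t => (2 * α / (2 - t)) ^ 2 - 2 * α * q t + α ^ 2) (𝓝[>] 0)
        (𝓝 (α ^ 2 - 2 * α * α + α ^ 2)) :=
      ((hup.pow 2).sub (hqlim.const_mul _)).add_const _
    rw [show α ^ 2 - 2 * α * α + α ^ 2 = 0 by ring] at hlim
    refine squeeze_zero' (Eventually.of_forall fun _ => by positivity) ?_ hlim
    filter_upwards [hIoo] with t ht
    have h1 : ‖coneQuotient φ τ ω t (1, 1) - α‖ ^ 2 = ‖coneQuotient φ τ ω t (1, 1)‖ ^ 2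
        - 2 * α * (coneQuotient φ τ ω t (1, 1)).re + α ^ 2 := by
      simp only [← Complex.normSq_eq_norm_sq, Complex.normSq_apply]
      simp
      ring
    rw [h1]
    have h2 := hnle t ht
    have h3 := hqle t ht
    gcongr
  rw [tendsto_iff_norm_sub_tendsto_zero]
  simpa [Real.sqrt_sq] using hsq.sqrt

/-- Julia is quadratic in `N = |1 - star ω * φ|`, but `1 - b ^ 2 ≤ 2 * N`, so one factor `N` cancels
and the bound is of order `t`. -/
theorem le_of_julia_cone {t d x N α b D : ℝ} (ht : 0 < t) (hα : 0 ≤ α) (hd : 0 < d)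
    (hx : t * d ≤ 1 - x ^ 2) (hN : 0 ≤ N) (hbN : 1 - b ≤ N) (hb1 : b ≤ 1)
    (h : (1 - x ^ 2) * N ^ 2 ≤ α * (1 - b ^ 2) * (t * D) ^ 2) :
    N / t ≤ 2 * α * (D ^ 2 / d) := by
  rw [← mul_div_assoc, div_le_div_iff₀ ht hd]
  rcases hN.eq_or_lt with h0 | h0
  · rw [← h0]; simp; positivity
  · have h2 : α * (1 - b ^ 2) ≤ α * (2 * N) := by
      gcongr; nlinarith
    have h3 : t * N * (N * d) ≤ t * N * (2 * α * D ^ 2 * t) := by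
      calc t * N * (N * d) = t * d * N ^ 2 := by ring
        _ ≤ (1 - x ^ 2) * N ^ 2 := by gcongr
        _ ≤ α * (1 - b ^ 2) * (t * D) ^ 2 := h
        _ ≤ α * (2 * N) * (t * D) ^ 2 := by gcongr
        _ = t * N * (2 * α * D ^ 2 * t) := by ring
    exact le_of_mul_le_mul_left h3 (mul_pos ht h0)

theorem norm_coneQuotient_le {φ : ℂ × ℂ → ℂ} (hφ : IsSchur φ) {τ : ℂ × ℂ}
    (hτ : τ ∈ torus) {ω : ℂ} (hω : ‖ω‖ = 1) {α : ℝ} (hα : 0 ≤ α) (hJ : JuliaIneq φ τ ω α)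
    {δ : ℂ × ℂ} (hδ : δ ∈ rightHalfPlanes) {t : ℝ} (ht : 0 < t)
    (h1 : t * ‖δ.1‖ ^ 2 ≤ δ.1.re) (h2 : t * ‖δ.2‖ ^ 2 ≤ δ.2.re) :
    ‖coneQuotient φ τ ω t δ‖ ≤ 2 * α * (‖δ.1‖ ^ 2 / δ.1.re + ‖δ.2‖ ^ 2 / δ.2.re) := by
  have hmem := conePoint_mem_bidisk hτ hδ ht h1 h2
  have hp1 : 0 ≤ ‖δ.1‖ ^ 2 / δ.1.re := div_nonneg (by positivity) hδ.1.le
  have hp2 : 0 ≤ ‖δ.2‖ ^ 2 / δ.2.re := div_nonneg (by positivity) hδ.2.le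
  have hN := one_sub_norm_le_norm hω (w := φ (conePoint τ δ t))
  rw [norm_coneQuotient ht]
  have e1 : ‖(conePoint τ δ t).1‖ = ‖1 - t * δ.1‖ := by simp [conePoint, hτ.1]
  have e2 : ‖(conePoint τ δ t).2‖ = ‖1 - t * δ.2‖ := by simp [conePoint, hτ.2]
  have e3 : ‖1 - star τ.1 * (conePoint τ δ t).1‖ = t * ‖δ.1‖ :=
    norm_one_sub_star_mul_mul hτ.1 ht δ.1
  have e4 : ‖1 - star τ.2 * (conePoint τ δ t).2‖ = t * ‖δ.2‖ :=
    norm_one_sub_star_mul_mul hτ.2 ht δ.2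
  have h := hJ _ hmem
  rw [e1, e2, e3, e4] at h
  rcases h with h | h
  · exact (le_of_julia_cone ht hα hδ.1 (by linarith [normSq_one_sub_mul_le ht h1]) (norm_nonneg _)
      hN (hφ.2 _ hmem) h).trans (by gcongr; linarith)
  · exact (le_of_julia_cone ht hα hδ.2 (by linarith [normSq_one_sub_mul_le ht h2]) (norm_nonneg _)
      hN (hφ.2 _ hmem) h).trans (by gcongr; linarith)

/-! ### Homogeneous limits and the Pick function -/

/-- A family on the product of two right half-planes, holomorphic and locally bounded for small
positive parameters. -/
def IsLocallyBoundedFamily (G : ℝ → ℂ × ℂ → ℂ) : Prop :=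
  ∀ δ ∈ rightHalfPlanes, ∃ r > 0, ∃ M : ℝ, ∀ᶠ t in 𝓝[>] (0 : ℝ),
    DifferentiableOn ℂ (G t) (ball δ r) ∧ ∀ η ∈ ball δ r, ‖G t η‖ ≤ M

theorem IsLocallyBoundedFamily.exists_limit_comp {G : ℝ → ℂ × ℂ → ℂ}
    (hG : IsLocallyBoundedFamily G) {U : Set ℂ} (hU : IsOpen U) (hUc : IsPreconnected U)
    {p : ℂ → ℂ × ℂ} (hp : DifferentiableOn ℂ p U) (hpU : MapsTo p U rightHalfPlanes)
    {z₀ : ℂ} (hz₀ : z₀ ∈ U)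
    (hc : ∃ᶠ z in 𝓝[≠] z₀, ∃ c, Tendsto (fun t => G t (p z)) (𝓝[>] 0) (𝓝 c)) :
    ∃ g : ℂ → ℂ, DifferentiableOn ℂ g U ∧
      ∀ z ∈ U, Tendsto (fun t => G t (p z)) (𝓝[>] 0) (𝓝 (g z)) := by
  refine exists_differentiableOn_limit (f := fun t z => G t (p z)) hU hUc (fun z hz => ?_) hz₀ hc
  obtain ⟨r, hr, M, hM⟩ := hG (p z) (hpU hz)
  have hpc : ContinuousAt p z := (hp.differentiableAt (hU.mem_nhds hz)).continuousAt
  obtain ⟨s, hs, hsub⟩ := Metric.mem_nhds_iff.1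
    (inter_mem (hpc (ball_mem_nhds _ hr)) (hU.mem_nhds hz))
  refine ⟨s, hs, M, ?_⟩
  filter_upwards [hM] with t ht
  exact ⟨ht.1.comp (hp.mono fun w hw => (hsub hw).2) fun w hw => (hsub hw).1,
    fun w hw => ht.2 _ (hsub hw).1⟩

theorem frequently_ofReal_one {P : ℂ → Prop} (h : ∀ s : ℝ, 0 < s → P s) :
    ∃ᶠ z in 𝓝[≠] (1 : ℂ), P z := by
  have ht : Tendsto (fun s : ℝ => (s : ℂ)) (𝓝[≠] 1) (𝓝[≠] 1) := by
    refine tendsto_nhdsWithin_iff.2 ⟨?_, ?_⟩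
    · simpa using (Complex.continuous_ofReal.tendsto (1 : ℝ)).mono_left nhdsWithin_le_nhds
    · filter_upwards [self_mem_nhdsWithin] with s hs
      simpa using hs
  refine ht.frequently (Eventually.frequently ?_)
  exact mem_nhdsWithin_of_mem_nhds ((lt_mem_nhds one_pos).mono h)

/-- Limits of a family that scales like a difference quotient are homogeneous of degree one
under complex scalars. -/
theorem IsLocallyBoundedFamily.tendsto_smul {G : ℝ → ℂ × ℂ → ℂ} (hG : IsLocallyBoundedFamily G)
    (hscale : ∀ s : ℝ, 0 < s → ∀ t : ℝ, 0 < t → ∀ a b : ℂ, G t (s * a, s * b) = s * G (s * t) (a, b))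
    {a b c u : ℂ} (hab : (a, b) ∈ rightHalfPlanes) (hu : (u * a, u * b) ∈ rightHalfPlanes)
    (hc : Tendsto (fun t => G t (a, b)) (𝓝[>] 0) (𝓝 c)) :
    Tendsto (fun t => G t (u * a, u * b)) (𝓝[>] 0) (𝓝 (u * c)) := by
  -- The admissible scalars form an intersection of two half-planes, convex and containing the
  -- positive reals, where `hscale` already gives the limit.
  set U : Set ℂ := {v | 0 < (v * a).re} ∩ {v | 0 < (v * b).re} with hUdef
  have hopen : ∀ d : ℂ, IsOpen {v : ℂ | 0 < (v * d).re} := fun d =>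
    isOpen_lt continuous_const (by fun_prop)
  have hconv : ∀ d : ℂ, Convex ℝ {v : ℂ | 0 < (v * d).re} := fun d =>
    convex_halfSpace_gt (f := fun v : ℂ => (v * d).re)
      ⟨fun x y => by simp [add_mul], fun k x => by simp; ring⟩ 0
  have hU : IsOpen U := (hopen a).inter (hopen b)
  have hUc : IsPreconnected U := ((hconv a).inter (hconv b)).isPreconnected
  have h1 : (1 : ℂ) ∈ U := by simpa [hUdef, rightHalfPlanes] using hab
  have hreal : ∀ s : ℝ, 0 < s → Tendsto (fun t => G t (s * a, s * b)) (𝓝[>] 0) (𝓝 (s * c)) := by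
    intro s hs
    have hst : Tendsto (fun t : ℝ => s * t) (𝓝[>] 0) (𝓝[>] 0) := by
      refine tendsto_nhdsWithin_iff.2 ⟨?_, ?_⟩
      · simpa using ((continuous_const_mul s).tendsto 0).mono_left nhdsWithin_le_nhds
      · filter_upwards [self_mem_nhdsWithin] with t ht using mul_pos hs ht
    refine ((hc.comp hst).const_mul (s : ℂ)).congr' ?_
    filter_upwards [self_mem_nhdsWithin] with t ht
    exact (hscale s hs t ht a b).symm
  obtain ⟨g, hgd, hg⟩ := hG.exists_limit_comp hU hUc (p := fun v => (v * a, v * b))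
    (by fun_prop) (fun v hv => hv) h1 (frequently_ofReal_one fun s hs => ⟨_, hreal s hs⟩)
  have hpos : ∀ s : ℝ, 0 < s → (s : ℂ) ∈ U := by
    intro s hs
    simp only [hUdef, mem_inter_iff, mem_ofPred_eq, Complex.re_ofReal_mul]
    exact ⟨mul_pos hs hab.1, mul_pos hs hab.2⟩
  have heq : EqOn g (fun v => v * c) U := by
    refine AnalyticOnNhd.eqOn_of_preconnected_of_frequently_eq (hgd.analyticOnNhd hU)
      (DifferentiableOn.analyticOnNhd (by fun_prop) hU) hUc h1 (frequently_ofReal_one fun s hs => ?_)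
    exact tendsto_nhds_unique (hg s (hpos s hs)) (hreal s hs)
  have huU : u ∈ U := hu
  have := hg u huU
  rwa [heq huU] at this

/-- On the slit plane the principal argument lies strictly between `-π` and `π`, so its half lies
strictly between `-π / 2` and `π / 2`. -/
theorem exp_mul_half_log_re_pos {z : ℂ} (hz : z ∈ slitPlane) {ε : ℝ} (hε : |ε| = 1) :
    0 < (exp (ε * (log z / 2))).re := by
  have h2 := Complex.neg_pi_lt_arg z
  have h3 : z.arg < Real.pi :=
    lt_of_le_of_ne (Complex.arg_le_pi z) (Complex.mem_slitPlane_iff_arg.1 hz).1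
  have him : (ε * (log z / 2)).im = ε * (z.arg / 2) := by
    rw [Complex.im_ofReal_mul, Complex.div_ofNat_im, Complex.log_im]
  rw [Complex.exp_re, him]
  refine mul_pos (Real.exp_pos _) (Real.cos_pos_of_mem_Ioo ?_)
  rcases eq_or_eq_neg_of_abs_eq hε with rfl | rfl
  · constructor <;> linarith
  · constructor <;> linarith

theorem exp_log_div_two_re_pos {z : ℂ} (hz : z ∈ slitPlane) : 0 < (exp (log z / 2)).re := by
  simpa using exp_mul_half_log_re_pos hz (ε := 1) (by simp)

theorem exp_neg_log_div_two_re_pos {z : ℂ} (hz : z ∈ slitPlane) :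
    0 < (exp (-(log z / 2))).re := by
  simpa using exp_mul_half_log_re_pos hz (ε := -1) (by simp)

theorem exp_log_div_two_sq {z : ℂ} (hz : z ≠ 0) : exp (log z / 2) * exp (log z / 2) = z := by
  rw [← Complex.exp_add, add_halves, Complex.exp_log hz]

theorem div_mem_slitPlane {δ : ℂ × ℂ} (hδ : δ ∈ rightHalfPlanes) : δ.2 / δ.1 ∈ slitPlane := by
  by_contra h
  have hne : δ.1 ≠ 0 := fun h0 => by simpa [h0] using hδ.1
  rw [Complex.mem_slitPlane_iff, not_or, not_lt, not_not] at h
  have hq : δ.2 / δ.1 = ((δ.2 / δ.1).re : ℂ) := Complex.ext rfl (by simpa using h.2)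
  have h2 : δ.2.re = (δ.2 / δ.1).re * δ.1.re := by
    rw [← Complex.re_ofReal_mul, ← hq, div_mul_cancel₀ _ hne]
  nlinarith [hδ.1, hδ.2, h.1]

theorem log_div_of_rightHalfPlanes {δ : ℂ × ℂ} (hδ : δ ∈ rightHalfPlanes) :
    log (δ.2 / δ.1) = log δ.2 - log δ.1 := by
  have h1 := Complex.abs_arg_lt_pi_div_two_iff.2 (Or.inl hδ.1)
  have h2 := Complex.abs_arg_lt_pi_div_two_iff.2 (Or.inl hδ.2)
  rw [abs_lt] at h1 h2
  have e1 : δ.1 ≠ 0 := fun h0 => by simpa [h0] using hδ.1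
  have e2 : δ.2 ≠ 0 := fun h0 => by simpa [h0] using hδ.2
  rw [← Complex.log_exp (x := log δ.2 - log δ.1), Complex.exp_sub, Complex.exp_log e1,
    Complex.exp_log e2]
  · simp only [Complex.sub_im, Complex.log_im]; linarith
  · simp only [Complex.sub_im, Complex.log_im]; linarith

theorem IsLocallyBoundedFamily.exists_pick {G : ℝ → ℂ × ℂ → ℂ} (hG : IsLocallyBoundedFamily G)
    (hscale : ∀ s : ℝ, 0 < s → ∀ t : ℝ, 0 < t → ∀ a b : ℂ, G t (s * a, s * b) = s * G (s * t) (a, b))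
    (hreal : ∀ x : ℝ, 0 < x → ∀ y : ℝ, 0 < y → ∃ c : ℝ,
      Tendsto (fun t => G t (x, y)) (𝓝[>] 0) (𝓝 (c : ℂ)))
    (hre : ∀ δ ∈ rightHalfPlanes, ∀ᶠ t in 𝓝[>] (0 : ℝ), 0 ≤ (G t δ).re) :
    ∃ h : ℂ → ℂ, IsPick h ∧ AnalyticOnNhd ℂ h slitPlane ∧
      (∀ x : ℝ, 0 < x → (h x).im = 0) ∧
      ∀ δ ∈ rightHalfPlanes,
        Tendsto (fun t => G t δ) (𝓝[>] 0) (𝓝 (-(δ.2 * h (δ.2 / δ.1)))) := by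
  -- The curve `(z^(-1/2), z^(1/2))` has coordinate ratio `z`, and it is real over the positive
  -- axis, where convergence is known.
  set p : ℂ → ℂ × ℂ := fun z => (exp (-(log z / 2)), exp (log z / 2)) with hp
  have hpd : DifferentiableOn ℂ p slitPlane := by
    have hl : DifferentiableOn ℂ (fun z => log z / 2) slitPlane := fun z hz =>
      ((Complex.differentiableAt_log hz).div_const 2).differentiableWithinAt
    exact hl.neg.cexp.prodMk hl.cexp
  have hpm : MapsTo p slitPlane rightHalfPlanes := fun z hz =>
    ⟨exp_neg_log_div_two_re_pos hz, exp_log_div_two_re_pos hz⟩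
  have hpreal : ∀ s : ℝ, 0 < s → p s =
      (((Real.exp (-(Real.log s / 2)) : ℝ) : ℂ), ((Real.exp (Real.log s / 2) : ℝ) : ℂ)) := by
    intro s hs
    simp only [hp, ← Complex.ofReal_log hs.le]
    push_cast
    rfl
  have hplim : ∀ s : ℝ, 0 < s → ∃ c : ℝ, Tendsto (fun t => G t (p s)) (𝓝[>] 0) (𝓝 (c : ℂ)) := by
    intro s hs
    rw [hpreal s hs]
    exact hreal _ (Real.exp_pos _) _ (Real.exp_pos _)
  obtain ⟨k, hkd, hk⟩ := hG.exists_limit_comp Complex.isOpen_slitPlane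
    ((Complex.starConvex_one_slitPlane.isPathConnected
      Complex.one_mem_slitPlane).isConnected.isPreconnected) hpd hpm
    Complex.one_mem_slitPlane
    (frequently_ofReal_one fun s hs => let ⟨c, hc⟩ := hplim s hs; ⟨(c : ℂ), hc⟩)
  set h : ℂ → ℂ := fun z => -(k z / exp (log z / 2)) with hh
  have hha : AnalyticOnNhd ℂ h slitPlane := by
    refine DifferentiableOn.analyticOnNhd ?_ Complex.isOpen_slitPlane
    have hl : DifferentiableOn ℂ (fun z => log z / 2) slitPlane := fun z hz =>
      ((Complex.differentiableAt_log hz).div_const 2).differentiableWithinAt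
    exact (hkd.div hl.cexp fun z _ => Complex.exp_ne_zero _).neg
  have hmain : ∀ δ ∈ rightHalfPlanes,
      Tendsto (fun t => G t δ) (𝓝[>] 0) (𝓝 (-(δ.2 * h (δ.2 / δ.1)))) := by
    intro δ hδ
    have e1 : δ.1 ≠ 0 := fun h0 => by simpa [h0] using hδ.1
    have e2 : δ.2 ≠ 0 := fun h0 => by simpa [h0] using hδ.2
    have hz := div_mem_slitPlane hδ
    set z := δ.2 / δ.1 with hzdef
    -- A square root of `δ.1 * δ.2`, formed with principal branches so that `u • p z = δ`.
    set u := exp (log δ.1 / 2) * exp (log δ.2 / 2) with hu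
    have hlog : log z / 2 = log δ.2 / 2 - log δ.1 / 2 := by
      rw [hzdef, log_div_of_rightHalfPlanes hδ]; ring
    have s1 := exp_log_div_two_sq e1
    have s2 := exp_log_div_two_sq e2
    have h1 : u * exp (-(log z / 2)) = δ.1 := by
      rw [hu, hlog, neg_sub, Complex.exp_sub, mul_assoc,
        mul_div_cancel₀ _ (Complex.exp_ne_zero _), s1]
    have h2 : u * exp (log z / 2) = δ.2 := by
      rw [hu, hlog, Complex.exp_sub, mul_right_comm,
        mul_div_cancel₀ _ (Complex.exp_ne_zero _), s2]
    have := hG.tendsto_smul hscale (u := u) (hpm hz) (by rw [h1, h2]; exact hδ) (hk z hz)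
    rw [h1, h2] at this
    have hval : -(δ.2 * h z) = u * k z := by
      have hne := Complex.exp_ne_zero (log z / 2)
      rw [hh]
      nth_rewrite 1 [← h2]
      field_simp
    rwa [hval]
  refine ⟨h, ⟨fun z hz => hha z (Or.inr hz.ne'), fun z hz => ?_⟩, hha, fun x hx => ?_, hmain⟩
  · have hz0 : z ≠ 0 := fun h0 => by simp [h0] at hz
    -- The direction `(I / z, I)` lies on the boundary of the domain; adding `ε` to `I` moves it
    -- inside while keeping the ratio `z`.
    have hge : ∀ᶠ ε : ℝ in 𝓝[>] 0, 0 ≤ (-((ε + I) * h z)).re := by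
      have hcont : Tendsto (fun ε : ℝ => ((ε + I) / z).re) (𝓝[>] 0) (𝓝 (I / z).re) := by
        have hc : Continuous fun ε : ℝ => ((ε + I) / z).re := by fun_prop
        simpa using (hc.tendsto 0).mono_left nhdsWithin_le_nhds
      have hpos : 0 < (I / z).re := by
        rw [Complex.div_re]
        have : 0 < normSq z := Complex.normSq_pos.2 hz0
        simp only [Complex.I_re, Complex.I_im, zero_mul, zero_div, zero_add, one_mul]
        exact div_pos hz this
      filter_upwards [hcont.eventually (lt_mem_nhds hpos), self_mem_nhdsWithin] with ε hε hε0
      have hδ : ((ε + I) / z, ε + I) ∈ rightHalfPlanes := ⟨hε, by simpa using hε0⟩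
      have hne : (ε + I : ℂ) ≠ 0 := fun h0 => by
        have := congrArg Complex.im h0
        simp at this
      have hlim := hmain _ hδ
      have hq : (ε + I) / ((ε + I) / z) = z := by field_simp
      simp only [hq] at hlim
      exact ge_of_tendsto ((Complex.continuous_re.tendsto _).comp hlim) (hre _ hδ)
    have hlim : Tendsto (fun ε : ℝ => (-((ε + I) * h z)).re) (𝓝[>] 0) (𝓝 (h z).im) := by
      have hc : Continuous fun ε : ℝ => (-((ε + I) * h z)).re := by fun_prop
      simpa using (hc.tendsto 0).mono_left (nhdsWithin_le_nhds (s := Ioi 0))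
    exact ge_of_tendsto hlim hge
  · obtain ⟨c, hc⟩ := hplim x hx
    have hx' : (x : ℂ) ∈ slitPlane := Complex.ofReal_mem_slitPlane.2 hx
    have hkx : k x = c := tendsto_nhds_unique (hk x hx') hc
    simp only [hh, hkx, ← Complex.ofReal_log hx.le]
    have : -((c : ℂ) / exp ((Real.log x : ℂ) / 2)) =
        ((-(c / Real.exp (Real.log x / 2)) : ℝ) : ℂ) := by push_cast; rfl
    rw [this, Complex.ofReal_im]

/-! ### Difference quotients of `φ` and real directions -/

theorem coneQuotient_scale (φ : ℂ × ℂ → ℂ) (τ : ℂ × ℂ) (ω : ℂ) {s : ℝ} (hs : 0 < s) (t : ℝ)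
    (a b : ℂ) :
    coneQuotient φ τ ω t (s * a, s * b) = s * coneQuotient φ τ ω (s * t) (a, b) := by
  have hs' : (s : ℂ) ≠ 0 := by exact_mod_cast hs.ne'
  have hpt : conePoint τ (s * a, s * b) t = conePoint τ (a, b) (s * t) := by
    simp only [conePoint, Complex.ofReal_mul]
    congr 3 <;> ring
  rw [coneQuotient, coneQuotient, hpt, Complex.ofReal_mul, ← mul_div_assoc,
    mul_div_mul_left _ _ hs']

theorem isLocallyBoundedFamily_coneQuotient {φ : ℂ × ℂ → ℂ} (hφ : IsSchur φ) {τ : ℂ × ℂ}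
    (hτ : τ ∈ torus) {ω : ℂ} (hω : ‖ω‖ = 1) {α : ℝ} (hα : 0 ≤ α) (hJ : JuliaIneq φ τ ω α) :
    IsLocallyBoundedFamily (coneQuotient φ τ ω) := by
  intro δ hδ
  set c := min δ.1.re δ.2.re with hc
  have hc0 : 0 < c := lt_min hδ.1 hδ.2
  set K := ‖δ‖ + c / 2 with hK
  have hK0 : 0 < K := by positivity
  -- On this ball real parts stay above `c / 2` and coordinates below `K`, making the Julia bound
  -- uniform.
  refine ⟨c / 2, by positivity, 2 * α * (K ^ 2 / (c / 2) + K ^ 2 / (c / 2)), ?_⟩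
  have hball : ∀ η ∈ ball δ (c / 2),
      c / 2 ≤ η.1.re ∧ c / 2 ≤ η.2.re ∧ ‖η.1‖ ≤ K ∧ ‖η.2‖ ≤ K := by
    intro η hη
    rw [mem_ball, dist_eq_norm] at hη
    have h1 : ‖η.1 - δ.1‖ ≤ ‖η - δ‖ := norm_fst_le (η - δ)
    have h2 : ‖η.2 - δ.2‖ ≤ ‖η - δ‖ := norm_snd_le (η - δ)
    have r1 := (abs_le.1 (Complex.abs_re_le_norm (η.1 - δ.1))).1
    have r2 := (abs_le.1 (Complex.abs_re_le_norm (η.2 - δ.2))).1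
    rw [Complex.sub_re] at r1 r2
    have c1 : c ≤ δ.1.re := min_le_left _ _
    have c2 : c ≤ δ.2.re := min_le_right _ _
    have hn : ‖η‖ ≤ K := by
      have := norm_sub_norm_le η δ
      linarith
    exact ⟨by linarith, by linarith, (norm_fst_le η).trans hn, (norm_snd_le η).trans hn⟩
  have hev : Ioo (0 : ℝ) (c / 2 / K ^ 2) ∈ 𝓝[>] (0 : ℝ) := Ioo_mem_nhdsGT (by positivity)
  filter_upwards [hev] with t ht
  have htK : t * K ^ 2 ≤ c / 2 := ((lt_div_iff₀ (by positivity)).1 ht.2).le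
  have ht0 := ht.1
  have hprop : ∀ η ∈ ball δ (c / 2), η ∈ rightHalfPlanes ∧ t * ‖η.1‖ ^ 2 ≤ η.1.re ∧
      t * ‖η.2‖ ^ 2 ≤ η.2.re := by
    intro η hη
    obtain ⟨a1, a2, a3, a4⟩ := hball η hη
    refine ⟨⟨by linarith, by linarith⟩, ?_, ?_⟩
    · exact le_trans (by gcongr) (htK.trans a1)
    · exact le_trans (by gcongr) (htK.trans a2)
  refine ⟨?_, fun η hη => ?_⟩
  · have hcomp : DifferentiableOn ℂ (fun η => φ (conePoint τ η t)) (ball δ (c / 2)) := by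
      refine hφ.differentiableOn.comp (g := φ) (f := fun η => conePoint τ η t) ?_ fun η hη => ?_
      · unfold conePoint; fun_prop
      · obtain ⟨b1, b2, b3⟩ := hprop η hη
        exact conePoint_mem_bidisk hτ b1 ht0 b2 b3
    have hd := ((hcomp.const_mul (star ω)).const_sub 1).mul_const ((t : ℂ)⁻¹)
    simp only [← div_eq_mul_inv] at hd
    exact hd
  · obtain ⟨a1, a2, a3, a4⟩ := hball η hη
    obtain ⟨b1, b2, b3⟩ := hprop η hη
    refine (norm_coneQuotient_le hφ hτ hω hα hJ b1 ht0 b2 b3).trans ?_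
    gcongr

theorem eventually_conePoint_mem {τ : ℂ × ℂ} (hτ : τ ∈ torus) {δ : ℂ × ℂ}
    (hδ : δ ∈ rightHalfPlanes) : ∀ᶠ t in 𝓝[>] (0 : ℝ), conePoint τ δ t ∈ bidisk := by
  have h : ∀ d : ℂ, 0 < d.re → ∀ᶠ t in 𝓝[>] (0 : ℝ), t * ‖d‖ ^ 2 ≤ d.re := by
    intro d hd
    have hc : Tendsto (fun t : ℝ => t * ‖d‖ ^ 2) (𝓝[>] 0) (𝓝 0) := by
      have hc : Continuous fun t : ℝ => t * ‖d‖ ^ 2 := by fun_prop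
      simpa using (hc.tendsto 0).mono_left (nhdsWithin_le_nhds (s := Ioi 0))
    exact (hc.eventually (gt_mem_nhds hd)).mono fun t ht => ht.le
  filter_upwards [h _ hδ.1, h _ hδ.2, self_mem_nhdsWithin] with t h1 h2 ht
  exact conePoint_mem_bidisk hτ hδ ht h1 h2

theorem norm_one_sub_ofReal_mul_lt {x : ℝ} (hx : 0 < x) (hx1 : x ≤ 1) {w : ℂ} (hw : ‖w‖ < 1) :
    ‖1 - x * (1 - w)‖ < 1 := by
  have h1 : (1 : ℂ) - x * (1 - w) = ((1 - x : ℝ) : ℂ) + x * w := by push_cast; ring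
  rw [h1]
  refine (norm_add_le _ _).trans_lt ?_
  rw [norm_mul, Complex.norm_real, Complex.norm_real, Real.norm_of_nonneg (by linarith),
    Real.norm_of_nonneg hx.le]
  nlinarith

/-- Along real directions in the unit square the difference quotient has a real limit: shrinking
the bidisk towards `τ` turns such a direction into the normal one. -/
theorem exists_tendsto_coneQuotient_of_le_one {φ : ℂ × ℂ → ℂ} (hφ : IsSchur φ) {τ : ℂ × ℂ}
    (hτ : τ ∈ torus) {ω : ℂ} (hω : ‖ω‖ = 1) {α : ℝ} (hα : 0 ≤ α) (hJ : JuliaIneq φ τ ω α)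
    {x y : ℝ} (hx : 0 < x) (hx1 : x ≤ 1) (hy : 0 < y) (hy1 : y ≤ 1) :
    ∃ c : ℝ, Tendsto (fun t => coneQuotient φ τ ω t (x, y)) (𝓝[>] 0) (𝓝 (c : ℂ)) := by
  -- Each coordinate is, up to rotation by `τ`, the convex combination `(1 - x) + x * z.1`; this is
  -- where `x ≤ 1` and `y ≤ 1` enter. `A` carries the normal segment at `(1, 1)` to the direction
  -- `(x, y)` at `τ`.
  set A : ℂ × ℂ → ℂ × ℂ := fun z => (τ.1 * (1 - x * (1 - z.1)), τ.2 * (1 - y * (1 - z.2))) with hA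
  have hAm : MapsTo A bidisk bidisk := by
    intro z hz
    refine ⟨?_, ?_⟩
    · rw [hA, norm_mul, hτ.1, one_mul]; exact norm_one_sub_ofReal_mul_lt hx hx1 hz.1
    · rw [hA, norm_mul, hτ.2, one_mul]; exact norm_one_sub_ofReal_mul_lt hy hy1 hz.2
  set ψ : ℂ × ℂ → ℂ := fun z => star ω * φ (A z) with hψ
  have hAan : AnalyticOnNhd ℂ A bidisk := by
    intro z _
    have h1 : AnalyticAt ℂ (fun z : ℂ × ℂ => z.1) z := analyticAt_fst
    have h2 : AnalyticAt ℂ (fun z : ℂ × ℂ => z.2) z := analyticAt_snd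
    exact (analyticAt_const.mul (analyticAt_const.sub (analyticAt_const.mul
      (analyticAt_const.sub h1)))).prod (analyticAt_const.mul (analyticAt_const.sub
      (analyticAt_const.mul (analyticAt_const.sub h2))))
  have hψS : IsSchur ψ := by
    refine ⟨analyticOnNhd_const.mul (hφ.1.comp hAan hAm), fun z hz => ?_⟩
    rw [hψ, norm_mul, norm_star, hω, one_mul]
    exact hφ.2 _ (hAm hz)
  have h11 : ((1, 1) : ℂ × ℂ) ∈ torus := by simp [torus]
  have hδ : ((x, y) : ℂ × ℂ) ∈ rightHalfPlanes := by simp [rightHalfPlanes, hx, hy]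
  have hApt : ∀ t : ℝ, A (conePoint (1, 1) (1, 1) t) = conePoint τ (x, y) t := by
    intro t
    simp only [hA, conePoint]
    congr 2 <;> ring
  obtain ⟨r, hr, M, hM⟩ := isLocallyBoundedFamily_coneQuotient hφ hτ hω hα hJ _ hδ
  have hbd : ∀ᶠ t in 𝓝[>] (0 : ℝ), ‖1 - ψ (conePoint (1, 1) (1, 1) t)‖ ≤ M * t := by
    filter_upwards [hM, self_mem_nhdsWithin] with t ht ht0
    have h := ht.2 _ (mem_ball_self hr)
    rw [norm_coneQuotient ht0, div_le_iff₀ ht0] at h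
    simpa only [hψ, hApt] using h
  have hfin : juliaLiminf ψ (1, 1) < ⊤ := by
    refine lt_of_le_of_lt (liminf_le_of_frequently_le' (x := ((M : ℝ) : EReal)) ?_)
      (EReal.coe_lt_top M)
    refine (tendsto_conePoint_one h11).frequently (Eventually.frequently ?_)
    filter_upwards [hbd, Ioo_mem_nhdsGT one_pos] with t ht ht0
    rw [EReal.coe_le_coe_iff, norm_conePoint_one h11 ht0, sub_sub_cancel, div_le_iff₀ ht0.1]
    have := norm_sub_norm_le (1 : ℂ) (ψ (conePoint (1, 1) (1, 1) t))
    rw [norm_one] at this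
    linarith
  obtain ⟨β, hβ0, hβ⟩ := hψS.exists_juliaLiminf_eq hfin
  obtain ⟨ω', hω', hJ'⟩ := hψS.exists_juliaIneq h11 hβ
  have hlim := tendsto_coneQuotient_one hψS h11 hω' hβ0 hβ hJ'
  have hid : Tendsto (fun t : ℝ => (t : ℂ)) (𝓝[>] 0) (𝓝 0) := by
    simpa using (Complex.continuous_ofReal.tendsto 0).mono_left (nhdsWithin_le_nhds (s := Ioi 0))
  -- The boundary value of `ψ` given by Julia must match its limit `1` along the normal.
  have hω1 : ω' = 1 := by
    have hψ1 : Tendsto (fun t => ψ (conePoint (1, 1) (1, 1) t)) (𝓝[>] 0) (𝓝 1) := by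
      rw [tendsto_iff_norm_sub_tendsto_zero]
      simp only [norm_sub_rev _ (1 : ℂ)]
      refine squeeze_zero' (Eventually.of_forall fun _ => norm_nonneg _) hbd ?_
      have hc : Continuous fun t : ℝ => M * t := by fun_prop
      simpa using (hc.tendsto 0).mono_left (nhdsWithin_le_nhds (s := Ioi 0))
    have h1 : Tendsto (fun t => 1 - star ω' * ψ (conePoint (1, 1) (1, 1) t)) (𝓝[>] 0)
        (𝓝 (1 - star ω' * 1)) := (hψ1.const_mul _).const_sub 1
    have h2 : Tendsto (fun t => 1 - star ω' * ψ (conePoint (1, 1) (1, 1) t)) (𝓝[>] 0)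
        (𝓝 (β * 0)) := by
      refine (hlim.mul hid).congr' ?_
      filter_upwards [self_mem_nhdsWithin] with t ht
      have ht' : (t : ℂ) ≠ 0 := by exact_mod_cast (ne_of_gt ht)
      rw [coneQuotient, div_mul_cancel₀ _ ht']
    have h3 := tendsto_nhds_unique h1 h2
    rw [mul_zero, mul_one, sub_eq_zero] at h3
    rw [← star_star ω', ← h3, star_one]
  refine ⟨β, hlim.congr fun t => ?_⟩
  simp only [coneQuotient, hω1, hψ, hApt, star_one, one_mul]

theorem exists_tendsto_coneQuotient_real {φ : ℂ × ℂ → ℂ} (hφ : IsSchur φ) {τ : ℂ × ℂ}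
    (hτ : τ ∈ torus) {ω : ℂ} (hω : ‖ω‖ = 1) {α : ℝ} (hα : 0 ≤ α) (hJ : JuliaIneq φ τ ω α)
    {x y : ℝ} (hx : 0 < x) (hy : 0 < y) :
    ∃ c : ℝ, Tendsto (fun t => coneQuotient φ τ ω t (x, y)) (𝓝[>] 0) (𝓝 (c : ℂ)) := by
  set s := max x y with hs
  have hs0 : 0 < s := lt_max_of_lt_left hx
  obtain ⟨c, hc⟩ := exists_tendsto_coneQuotient_of_le_one hφ hτ hω hα hJ (div_pos hx hs0)
    ((div_le_one hs0).2 (le_max_left _ _)) (div_pos hy hs0) ((div_le_one hs0).2 (le_max_right _ _))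
  have hsc : (s : ℂ) ≠ 0 := by exact_mod_cast hs0.ne'
  refine ⟨s * c, ?_⟩
  have hδ : (((x / s : ℝ) : ℂ), ((y / s : ℝ) : ℂ)) ∈ rightHalfPlanes :=
    ⟨by rw [Complex.ofReal_re]; positivity, by rw [Complex.ofReal_re]; positivity⟩
  have hx' : (s : ℂ) * ((x / s : ℝ) : ℂ) = x := by push_cast; field_simp
  have hy' : (s : ℂ) * ((y / s : ℝ) : ℂ) = y := by push_cast; field_simp
  have := (isLocallyBoundedFamily_coneQuotient hφ hτ hω hα hJ).tendsto_smul
    (fun s hs t _ a b => coneQuotient_scale φ τ ω hs t a b) (u := s) hδ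
    (by rw [hx', hy']; simp [rightHalfPlanes, hx, hy]) hc
  rw [hx', hy'] at this
  simpa using this

end BidiskPick

/-! ### Assembly -/

theorem theorem4 (φ : ℂ × ℂ → ℂ) (hφ : BidiskPick.IsSchur φ)
    (τ : ℂ × ℂ) (hτ : τ ∈ BidiskPick.torus) (hB : BidiskPick.IsBPoint φ τ) :
    ∃ ω : ℂ, BidiskPick.HasNontangentialLimit φ τ ω ∧
      ∃ h : ℂ → ℂ,
        BidiskPick.IsPick h ∧
        AnalyticOnNhd ℂ h Complex.slitPlane ∧
        (∀ x : ℝ, 0 < x → (h (x : ℂ)).im = 0) ∧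
        (∃ α : ℝ, BidiskPick.juliaLiminf φ τ = (α : EReal) ∧ h 1 = -(α : ℂ)) ∧
        ∀ δ ∈ BidiskPick.coneAt τ,
          BidiskPick.HasDirectionalDeriv φ τ ω (-δ)
            (ω * (star τ.2 * δ.2) * h ((star τ.2 * δ.2) / (star τ.1 * δ.1))) := by
  open BidiskPick in
  obtain ⟨α, hα0, hα⟩ := hφ.exists_juliaLiminf_eq hB.2
  obtain ⟨ω, hω, hJ⟩ := hφ.exists_juliaIneq hτ hα
  refine ⟨ω, hJ.hasNontangentialLimit hτ hω hα0, ?_⟩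
  obtain ⟨h, hpick, han, hreal, hlim⟩ :=
    (isLocallyBoundedFamily_coneQuotient hφ hτ hω hα0 hJ).exists_pick
      (fun s hs t _ a b => coneQuotient_scale φ τ ω hs t a b)
      (fun x hx y hy => exists_tendsto_coneQuotient_real hφ hτ hω hα0 hJ hx hy)
      (fun δ hδ => by
        filter_upwards [eventually_conePoint_mem hτ hδ, self_mem_nhdsWithin] with t ht ht0
        exact coneQuotient_re_nonneg hφ hω ht0 ht)
  refine ⟨h, hpick, han, hreal, ⟨α, hα, ?_⟩, fun δ hδ => ?_⟩
  · have h1 := tendsto_nhds_unique (hlim (1, 1) one_one_mem_rightHalfPlanes)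
      (tendsto_coneQuotient_one hφ hτ hω hα0 hα hJ)
    simp only [div_one, one_mul] at h1
    rw [← h1, neg_neg]
  · have h1 := (hlim (star τ.1 * δ.1, star τ.2 * δ.2) hδ).const_mul (-ω)
    have hval : -ω * -(star τ.2 * δ.2 * h (star τ.2 * δ.2 / (star τ.1 * δ.1))) =
        ω * (star τ.2 * δ.2) * h (star τ.2 * δ.2 / (star τ.1 * δ.1)) := by ring
    simp only [hval] at h1
    refine h1.congr fun t => ?_
    have hpt : conePoint τ (star τ.1 * δ.1, star τ.2 * δ.2) t = τ + t • (-δ) := by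
      have m1 := star_mul_self_of_norm_eq_one hτ.1
      have m2 := star_mul_self_of_norm_eq_one hτ.2
      refine Prod.ext ?_ ?_
      · simp only [conePoint, Prod.fst_add, Prod.smul_fst, Prod.fst_neg, Complex.real_smul]
        linear_combination -(t * δ.1) * m1
      · simp only [conePoint, Prod.snd_add, Prod.smul_snd, Prod.snd_neg, Complex.real_smul]
        linear_combination -(t * δ.2) * m2
    rw [coneQuotient, hpt, ← mul_div_assoc]
    congr 1
    linear_combination φ (τ + t • (-δ)) * star_mul_self_of_norm_eq_one hω
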